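/- \textbf{Theorem (Excision and Mayer--Vietoris for reachability homology).} \emph{Conventions.} A directed graph $G$ consists of a set $V(G)$ of vertices and a set $E(G)\subseteq V(G)\times V(G)$ of directed edges. A map of directed graphs $G\to H$ is a function $f\colon V(G)\to V(H)$ such that for each edge $u\to v$ of $G$ either $f(u)=f(v)$ or $f(u)\to f(v)$ is an edge of $H$. Directed graphs and their maps form the category $\mathrm{DiGraph}$. A (directed) path in $G$ is a finite tuple of vertices, each of which is equal to the next one or joined to it by a directed edge. Fix a commutative ground ring $R$. The reachability complex $\mathrm{RC}_*(G)$ is the chain complex of $R$-modules that in degree $k\ge 0$ is freely generated by the tuples $(v_0,\dots,v_k)$ of vertices of $G$ such that $v_{j-1}\neq v_j$ and there is a path in $G$ from $v_{j-1}$ to $v_j$, for $j=1,\dots,k$. Its differential is $\partial(v_0,\dots,v_k)=\sum_{j=0}^k(-1)^j(v_0,\dots,\widehat{v_j},\dots,v_k)$, where terms in which adjacent entries coincide are omitted. A map $f\colon G\to H$ induces the chain map $(v_0,\dots,v_k)\mapsto(f(v_0),\dots,f(v_k))$, where again tuples in which adjacent entries coincide are read as $0$. The reachability homology of $G$ is $\mathrm{RH}_*(G)=H_*(\mathrm{RC}_*(G))$.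 For a subgraph $A\subseteq G$, the relative reachability homology is $\mathrm{RH}_*(G,A)=H_*(\mathrm{RC}_*(G)/\mathrm{RC}_*(A))$. A \emph{long cofibration} $i\colon A\to X$ is an induced subgraph inclusion such that (1) there is no path in $X$ from a vertex not in $A$ to a vertex of $A$; (2) for each vertex $x$ of $X$ that admits a path from some vertex of $A$, there is a vertex $\pi(x)$ of $A$ such that, for each vertex $a$ of $A$, there is a path in $X$ from $a$ to $x$ if and only if there is a path from $a$ to $\pi(x)$. \emph{Statement.} Let $i\colon A\to X$ be a long cofibration of directed graphs, let $f\colon A\to Y$ be any map of directed graphs, and let $X\cup_A Y$ be their pushout in $\mathrm{DiGraph}$, with structure maps $g\colon X\to X\cup_A Y$ and $j\colon Y\to X\cup_A Y$. Then $j$ is injective on vertices, so that $\mathrm{RC}_*(Y)$ is a subcomplex of $\mathrm{RC}_*(X\cup_A Y)$ via $j$, and the following hold. (a) (Excision) For every $n\ge 0$ the map $$g_*\colon \mathrm{RH}_n(X,A)\longrightarrow \mathrm{RH}_n(X\cup_A Y,Y)$$ induced by $g$ is an isomorphism. (b) (Mayer--Vietoris) There are $R$-linear maps $\partial_*\colon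 \mathrm{RH}_{n+1}(X\cup_A Y)\to\mathrm{RH}_n(A)$, for $n\ge 0$, that make the sequence $$\cdots\to \mathrm{RH}_{n+1}(X\cup_A Y)\xrightarrow{\ \partial_*\ }\mathrm{RH}_n(A)\xrightarrow{\ (-i_*,\,f_*)\ }\mathrm{RH}_n(X)\oplus\mathrm{RH}_n(Y)\xrightarrow{\ g_*+j_*\ }\mathrm{RH}_n(X\cup_A Y)\to\cdots$$ exact; it ends with $\mathrm{RH}_0(X)\oplus\mathrm{RH}_0(Y)\to\mathrm{RH}_0(X\cup_A Y)\to 0$. -/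

import Mathlib

open CategoryTheory CategoryTheory.Limits

universe w u

/-- A directed graph: a type of vertices together with a binary relation giving the directed
edges. Loops are allowed but not required, and there are no multiple edges. -/
structure DiGraph : Type (u + 1) where
  /-- The vertices. -/
  V : Type u
  /-- The directed edges. -/
  graph : Digraph V

namespace DiGraph

/-- There is a directed edge `a → b` in `G`. -/
def Edge (G : DiGraph.{u}) (a b : G.V) : Prop := G.graph.Adj a b

/-- A map of directed graphs preserves or contracts each edge. -/
@[ext]
structure Hom (G H : DiGraph.{u}) : Type u where
  /-- The function on vertices. -/
  toFun : G.V → H.V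
  map_edge : ∀ a b, G.Edge a b → toFun a = toFun b ∨ H.Edge (toFun a) (toFun b)

instance : Category DiGraph.{u} where
  Hom := Hom
  id G := ⟨id, fun _ _ h => Or.inr h⟩
  comp f g := ⟨g.toFun ∘ f.toFun, fun a b h => by
    rcases f.map_edge a b h with h | h
    · exact Or.inl (congrArg g.toFun h)
    · exact g.map_edge _ _ h⟩

/-- The reachability preorder of `G`: there is a directed path from `a` to `b` in `G`, that is,
a finite tuple of vertices starting with `a` and ending with `b`, each joined to the
next one by a directed edge. -/
def Reach (G : DiGraph.{u}) (a b : G.V) : Prop := Relation.ReflTransGen G.Edge a b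

theorem Hom.map_reach {G H : DiGraph.{u}} (f : G ⟶ H) {a b : G.V} (h : G.Reach a b) :
    H.Reach (f.toFun a) (f.toFun b) := by
  induction h with
  | refl => exact Relation.ReflTransGen.refl
  | tail _ e ih =>
    rcases f.map_edge _ _ e with h | h
    · rwa [← h]
    · exact ih.tail h

/-- A long cofibration `i : A ⟶ X` of directed graphs. -/
structure IsLongCofibration {A X : DiGraph.{u}} (i : A ⟶ X) : Prop where
  /-- `i` is injective on vertices ... -/
  injective : Function.Injective i.toFun
  /-- ... and identifies `A` with an induced subgraph of `X`. -/
  edge_iff : ∀ a b : A.V, A.Edge a b ↔ X.Edge (i.toFun a) (i.toFun b)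
  /-- There are no paths in `X` from vertices not in `A` to vertices in `A`. -/
  not_reach : ∀ x : X.V, x ∉ Set.range i.toFun → ∀ a : A.V, ¬ X.Reach x (i.toFun a)
  /-- For each vertex `x` in the reach of `A`, there is a vertex `p` of `A` such that a vertex of
  `A` admits a path to `x` if and only if it admits a path to `p`. -/
  exists_retract : ∀ x : X.V, (∃ a : A.V, X.Reach (i.toFun a) x) →
    ∃ p : A.V, ∀ a : A.V, X.Reach (i.toFun a) x ↔ X.Reach (i.toFun a) (i.toFun p)

/-! ### The reachability complex -/

/-- A tuple `(v₀, …, vₖ)` of vertices in which each entry can reach the next. -/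
def IsChain (G : DiGraph.{u}) {k : ℕ} (v : Fin (k + 1) → G.V) : Prop :=
  ∀ j : Fin k, G.Reach (v j.castSucc) (v j.succ)

/-- A tuple `(v₀, …, vₖ)` of vertices in which adjacent entries are distinct and each entry can
reach the next. -/
def IsRegular (G : DiGraph.{u}) {k : ℕ} (v : Fin (k + 1) → G.V) : Prop :=
  ∀ j : Fin k, v j.castSucc ≠ v j.succ ∧ G.Reach (v j.castSucc) (v j.succ)

theorem IsRegular.isChain {G : DiGraph.{u}} {k : ℕ} {v : Fin (k + 1) → G.V}
    (h : G.IsRegular v) : G.IsChain v := fun j => (h j).2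

/-- The generators of the reachability complex in degree `k`. -/
abbrev RegTuple (G : DiGraph.{u}) (k : ℕ) : Type u := {v : Fin (k + 1) → G.V // G.IsRegular v}

variable (R : Type w) [CommRing R]

/-- The chains of degree `k`: the free `R`-module on the regular tuples `(v₀, …, vₖ)`. -/
abbrev Chains (G : DiGraph.{u}) (k : ℕ) : Type max u w := G.RegTuple k →₀ R

open Classical in
/-- The tuple `v` as an element of the reachability complex: the corresponding generator if `v`
is regular, and zero otherwise. It is only applied to tuples in which each entry can reach the next,
so that it is zero exactly when two adjacent entries coincide. -/
noncomputable def gen (G : DiGraph.{u}) {k : ℕ} (v : Fin (k + 1) → G.V) : G.Chains R k :=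
  if h : G.IsRegular v then Finsupp.single ⟨v, h⟩ 1 else 0

/-- The differential, `∂(v₀, …, vₖ₊₁) = ∑ⱼ (-1)ʲ (v₀, …, v̂ⱼ, …, vₖ₊₁)`, where the terms in which
adjacent entries coincide are omitted. -/
noncomputable def boundary (G : DiGraph.{u}) (k : ℕ) : G.Chains R (k + 1) →ₗ[R] G.Chains R k :=
  Finsupp.linearCombination R fun v : G.RegTuple (k + 1) =>
    ∑ j : Fin (k + 2), (-1 : R) ^ (j : ℕ) • G.gen R (v.1 ∘ j.succAbove)

/-- The map `(v₀, …, vₖ) ↦ (f(v₀), …, f(vₖ))` on chains, where the image is zero if adjacent entries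
of it coincide. -/
noncomputable def chainsMap {G H : DiGraph.{u}} (f : G ⟶ H) (k : ℕ) :
    G.Chains R k →ₗ[R] H.Chains R k :=
  Finsupp.linearCombination R fun v : G.RegTuple k => H.gen R (f.toFun ∘ v.1)

variable {R}

theorem gen_of_eq {G : DiGraph.{u}} {k : ℕ} {v : Fin (k + 1) → G.V} (p : Fin k)
    (h : v p.castSucc = v p.succ) : G.gen R v = 0 :=
  dif_neg fun hv => (hv p).1 h

theorem gen_of_isRegular {G : DiGraph.{u}} {k : ℕ} {v : Fin (k + 1) → G.V}
    (h : G.IsRegular v) : G.gen R v = Finsupp.single ⟨v, h⟩ 1 := dif_pos h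

theorem IsChain.regular_or {G : DiGraph.{u}} {k : ℕ} {v : Fin (k + 1) → G.V} (h : G.IsChain v) :
    G.IsRegular v ∨ ∃ p : Fin k, v p.castSucc = v p.succ := by
  by_cases hp : ∃ p : Fin k, v p.castSucc = v p.succ
  · exact Or.inr hp
  · push Not at hp
    exact Or.inl fun j => ⟨hp j, h j⟩

theorem IsChain.map {G H : DiGraph.{u}} (f : G ⟶ H) {k : ℕ} {v : Fin (k + 1) → G.V}
    (h : G.IsChain v) : H.IsChain (f.toFun ∘ v) := fun j => Hom.map_reach f (h j)

theorem IsChain.face {G : DiGraph.{u}} {k : ℕ} {v : Fin (k + 2) → G.V}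
    (h : G.IsChain v) (i : Fin (k + 2)) : G.IsChain (v ∘ i.succAbove) := by
  intro j
  have key : ∀ (a b : ℕ) (ha : a < k + 2) (hb : b < k + 2), a ≤ b → G.Reach (v ⟨a, ha⟩) (v ⟨b, hb⟩) := by
    intro a b ha hb hab
    induction b, hab using Nat.le_induction with
    | base => exact Relation.ReflTransGen.refl
    | succ b hab ih => exact (ih (by omega)).trans (h ⟨b, by omega⟩)
  exact key _ _ _ _ (Fin.le_def.1 (i.strictMono_succAbove.monotone (Fin.castSucc_lt_succ (i := j)).le))

theorem boundary_gen {G : DiGraph.{u}} {k : ℕ} {v : Fin (k + 2) → G.V} (h : G.IsChain v) :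
    G.boundary R k (G.gen R v) =
      ∑ j : Fin (k + 2), (-1 : R) ^ (j : ℕ) • G.gen R (v ∘ j.succAbove) := by
  rcases h.regular_or with hv | ⟨p, hp⟩
  · simp [boundary, gen_of_isRegular hv]
  · rw [gen_of_eq p hp, map_zero]
    have hne : p.castSucc ≠ p.succ := (Fin.castSucc_lt_succ (i := p)).ne
    rw [← Finset.sum_subset (Finset.subset_univ {p.castSucc, p.succ}), Finset.sum_pair hne]
    · have hface : v ∘ p.castSucc.succAbove = v ∘ p.succ.succAbove := by
        funext q
        rcases lt_trichotomy q p with hq | rfl | hq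
        · simp only [Function.comp]
          congr 1
          ext
          simp only [Fin.succAbove, Fin.lt_def, Fin.val_castSucc, Fin.val_succ] at hq ⊢
          split_ifs <;> simp <;> omega
        · simp [hp]
        · simp only [Function.comp]
          congr 1
          ext
          simp only [Fin.succAbove, Fin.lt_def, Fin.val_castSucc, Fin.val_succ] at hq ⊢
          split_ifs <;> simp <;> omega
      rw [hface]
      simp [pow_succ]
    · intro i _ hi
      simp only [Finset.mem_insert, Finset.mem_singleton, not_or] at hi
      obtain ⟨h1, h2⟩ := hi
      have h1' : (i : ℕ) ≠ p := fun e => h1 (Fin.ext e)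
      have h2' : (i : ℕ) ≠ p + 1 := fun e => h2 (Fin.ext e)
      have hpk := p.2
      have hik := i.2
      have hlt : ∃ q : Fin k, i.succAbove q.castSucc = p.castSucc ∧ i.succAbove q.succ = p.succ := by
        rcases lt_or_ge (i : ℕ) p with hip | hip
        · refine ⟨⟨p - 1, by omega⟩, ?_, ?_⟩ <;> ext <;>
            simp only [Fin.succAbove, Fin.lt_def, Fin.val_castSucc, Fin.val_succ] <;>
            split_ifs <;> simp <;> omega
        · refine ⟨⟨p, by omega⟩, ?_, ?_⟩ <;> ext <;>
            simp only [Fin.succAbove, Fin.lt_def, Fin.val_castSucc, Fin.val_succ] <;>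
            split_ifs <;> simp <;> omega
      obtain ⟨q, hq1, hq2⟩ := hlt
      rw [gen_of_eq q (by simp only [Function.comp, hq1, hq2, hp]), smul_zero]

theorem boundary_comp_boundary (G : DiGraph.{u}) (k : ℕ) :
    G.boundary R k ∘ₗ G.boundary R (k + 1) = 0 := by
  ext1 v
  ext1
  have hv : G.IsChain v.1 := v.2.isChain
  have : (Finsupp.single v 1 : G.Chains R (k + 2)) = G.gen R v.1 := (gen_of_isRegular v.2).symm
  simp only [LinearMap.comp_apply, Finsupp.lsingle_apply, LinearMap.zero_apply, this]
  rw [boundary_gen hv, map_sum]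
  simp only [map_smul, boundary_gen (hv.face _), Finset.smul_sum, smul_smul]
  rw [← Finset.sum_product']
  refine Finset.sum_involution
    (fun ij _ => (ij.1.succAbove ij.2, ij.2.predAbove ij.1)) ?_ ?_ ?_ ?_
  · rintro ⟨i, j⟩ -
    have hc : (v.1 ∘ (i.succAbove j).succAbove) ∘ (j.predAbove i).succAbove =
        (v.1 ∘ i.succAbove) ∘ j.succAbove := by
      funext q
      exact congrArg v.1 (Fin.succAbove_succAbove_succAbove_predAbove i j q)
    simp only [hc, ← pow_add, Fin.neg_one_pow_succAbove_add_predAbove, neg_smul]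
    exact add_neg_cancel _
  · rintro ⟨i, j⟩ - - h
    exact Fin.succAbove_ne _ _ (congrArg Prod.fst h)
  · intros
    exact Finset.mem_univ _
  · rintro ⟨i, j⟩ -
    exact Prod.ext (Fin.succAbove_succAbove_predAbove i j) (Fin.predAbove_predAbove_succAbove i j)

theorem chainsMap_gen {G H : DiGraph.{u}} (f : G ⟶ H) {k : ℕ} {v : Fin (k + 1) → G.V}
    (h : G.IsChain v) : chainsMap R f k (G.gen R v) = H.gen R (f.toFun ∘ v) := by
  rcases h.regular_or with hv | ⟨p, hp⟩
  · simp [chainsMap, gen_of_isRegular hv]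
  · rw [gen_of_eq p hp, gen_of_eq p (congrArg f.toFun hp), map_zero]

theorem boundary_comp_chainsMap {G H : DiGraph.{u}} (f : G ⟶ H) (k : ℕ) :
    H.boundary R k ∘ₗ chainsMap R f (k + 1) = chainsMap R f k ∘ₗ G.boundary R k := by
  ext1 v
  ext1
  have hv : G.IsChain v.1 := v.2.isChain
  have : (Finsupp.single v 1 : G.Chains R (k + 1)) = G.gen R v.1 := (gen_of_isRegular v.2).symm
  simp only [LinearMap.comp_apply, Finsupp.lsingle_apply, this]
  rw [chainsMap_gen f hv, boundary_gen (hv.map f), boundary_gen hv, map_sum]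
  simp only [map_smul, chainsMap_gen f (hv.face _), Function.comp_assoc]

variable (R)

/-- The reachability complex `RC(G)`, a chain complex of `R`-modules. -/
noncomputable def RCobj (G : DiGraph.{u}) : ChainComplex (ModuleCat.{max u w} R) ℕ :=
  ChainComplex.of (fun k => ModuleCat.of R (G.Chains R k))
    (fun k => ModuleCat.ofHom (G.boundary R k))
    (fun k => by rw [← ModuleCat.ofHom_comp, boundary_comp_boundary]; rfl)

/-- The chain map `RC(G) ⟶ RC(H)` induced by a map of directed graphs. -/
noncomputable def RCmap {G H : DiGraph.{u}} (f : G ⟶ H) : RCobj R G ⟶ RCobj R H where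
  f k := ModuleCat.ofHom (chainsMap R f k)
  comm' k l hkl := by
    obtain rfl : l + 1 = k := hkl
    simp only [RCobj, ChainComplex.of_d]
    rw [← ModuleCat.ofHom_comp, ← ModuleCat.ofHom_comp, boundary_comp_chainsMap]

theorem chainsMap_id (G : DiGraph.{u}) (k : ℕ) : chainsMap R (𝟙 G) k = LinearMap.id := by
  refine Finsupp.lhom_ext' fun v => LinearMap.ext_ring ?_
  have : (Finsupp.single v 1 : G.Chains R k) = G.gen R v.1 := (gen_of_isRegular v.2).symm
  simp only [LinearMap.comp_apply, Finsupp.lsingle_apply, this]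
  rw [chainsMap_gen _ v.2.isChain]
  rfl

theorem chainsMap_comp {G H K : DiGraph.{u}} (f : G ⟶ H) (g : H ⟶ K) (k : ℕ) :
    chainsMap R (f ≫ g) k = chainsMap R g k ∘ₗ chainsMap R f k := by
  refine Finsupp.lhom_ext' fun v => LinearMap.ext_ring ?_
  have : (Finsupp.single v 1 : G.Chains R k) = G.gen R v.1 := (gen_of_isRegular v.2).symm
  simp only [LinearMap.comp_apply, Finsupp.lsingle_apply, this]
  rw [chainsMap_gen _ v.2.isChain, chainsMap_gen _ v.2.isChain,
    chainsMap_gen _ (v.2.isChain.map f)]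
  rfl

/-- The reachability complex as a functor from directed graphs to chain complexes of
`R`-modules. -/
noncomputable def RC : DiGraph.{u} ⥤ ChainComplex (ModuleCat.{max u w} R) ℕ where
  obj := RCobj R
  map f := RCmap R f
  map_id G := HomologicalComplex.hom_ext _ _ fun k =>
    ModuleCat.hom_ext (chainsMap_id R G k)
  map_comp f g := HomologicalComplex.hom_ext _ _ fun k =>
    ModuleCat.hom_ext (chainsMap_comp R f g k)

/-- Reachability homology in degree `n`. -/
noncomputable abbrev RH (n : ℕ) (G : DiGraph.{u}) : ModuleCat.{max u w} R :=
  ((RC R).obj G).homology n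

/-- The map induced on reachability homology in degree `n` by a map of directed graphs. -/
noncomputable def RH.map (n : ℕ) {G H : DiGraph.{u}} (f : G ⟶ H) :
    RH R n G →ₗ[R] RH R n H :=
  (HomologicalComplex.homologyMap ((RC R).map f) n).hom

/-- The relative reachability complex `RC(X, A) = RC(X) / RC(A)` of an inclusion `i : A ⟶ X`: the
quotient of the chain complex `RC(X)` by the image of `RC(A)`. -/
noncomputable abbrev relRC {A X : DiGraph.{u}} (i : A ⟶ X) :
    ChainComplex (ModuleCat.{max u w} R) ℕ :=
  cokernel ((RC R).map i)

/-- Relative reachability homology `RH_n(X, A)` for an inclusion `i : A ⟶ X`. -/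
noncomputable abbrev relRH (n : ℕ) {A X : DiGraph.{u}} (i : A ⟶ X) : ModuleCat.{max u w} R :=
  (relRC R i).homology n

/-- The map `RH_n(X, A) → RH_n(Z, Y)` induced by `g : X ⟶ Z` restricting to `f : A ⟶ Y`. -/
noncomputable def relRH.map (n : ℕ) {A X Y Z : DiGraph.{u}} {i : A ⟶ X} {j : Y ⟶ Z}
    (f : A ⟶ Y) (g : X ⟶ Z) (sq : i ≫ g = f ≫ j) : relRH R n i →ₗ[R] relRH R n j :=
  (HomologicalComplex.homologyMap
    (cokernel.map ((RC R).map i) ((RC R).map j) ((RC R).map f) ((RC R).map g)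
      (by rw [← Functor.map_comp, ← Functor.map_comp, sq])) n).hom

end DiGraph

/-!
Reachability homology depends on a graph only through its reachability preorder, so it is invariant
under adjunctions of preorders. Precisely, two maps `f ≤ g` into a graph are chain homotopic
(`homologyMap_eq_of_reach`), by the prism operator. It is computed on formal sums of lists, where
both the boundary and the prism have a recursive description and the homotopy identity is a short
induction (`listBoundaryₗ_listPrism`), and then transferred to the reachability complex.

Let `U ⊆ X` be the set of vertices that admit a path from `A`. The retraction `π` of a long
cofibration is a monotone map `U → A` right adjoint to the inclusion. It need not be a map of
graphs, but it is one into the graph with an edge for each path of `A`, whose reachability complex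
is that of `A`. Hence `A → U` is a quasi-isomorphism (`IsCoreflective.quasiIso`).

The reachability preorder of the pushout `Z` is determined explicitly (`IsGluing`): its vertices
are those of `Y` and those of `X` outside of `A`, no path leads from the latter to the former, and a
path from `y` to `x` exists exactly if `y` reaches some `f a` with `a` reaching `x`. It follows that
`Y` has the same retraction property in `Z`, so that the inclusion of `Y` into its upward closure
`U'` is a quasi-isomorphism too. Relative to the upward closures excision holds already on chains:
both `RC(X)/RC(U)` and `RC(Z)/RC(U')` are free on the tuples that start outside of the upward
closure; these never meet `A` or `Y`, and `g` matches them (`IsGluing.isIso_relRCMap`). The five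
lemma then yields excision for `(X, A) → (Z, Y)`.

The Mayer–Vietoris sequence results from the map between the long exact sequences of the two pairs,
in which every third map is an isomorphism (the Barratt–Whitehead lemma).
-/

namespace DiGraph

/-! ### Formal sums of lists and the prism operator -/

section Lists

variable (R : Type w) [CommRing R] {V W : Type u}

/-- The augmented boundary of a list, `∑ⱼ (-1)ʲ (a₀, …, âⱼ, …, aₖ)` (with no degenerate terms
omitted), in the recursive form `∂(a :: l) = l - a :: ∂l`. -/
noncomputable def listBoundary : List V → (List V →₀ R)
  | [] => 0
  | a :: l => Finsupp.single l 1 - Finsupp.lmapDomain R R (List.cons a) (listBoundary l)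

/-- The prism `∑ⱼ (-1)ʲ (f a₀, …, f aⱼ, g aⱼ, …, g aₖ)` on a list, in the recursive form
`P(a :: l) = f a :: g a :: g l - f a :: P l`. -/
noncomputable def listPrism (f g : V → W) : List V → (List W →₀ R)
  | [] => 0
  | a :: l => Finsupp.single (f a :: g a :: l.map g) 1 -
      Finsupp.lmapDomain R R (List.cons (f a)) (listPrism f g l)

/-- The linear extension of `listBoundary`. -/
noncomputable abbrev listBoundaryₗ : (List V →₀ R) →ₗ[R] (List V →₀ R) :=
  Finsupp.linearCombination R (listBoundary R)

/-- The linear extension of `listPrism`. -/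
noncomputable abbrev listPrismₗ (f g : V → W) : (List V →₀ R) →ₗ[R] (List W →₀ R) :=
  Finsupp.linearCombination R (listPrism R f g)

variable {R}

theorem listBoundaryₗ_cons (a : V) (x : List V →₀ R) :
    listBoundaryₗ R (Finsupp.lmapDomain R R (List.cons a) x) =
      x - Finsupp.lmapDomain R R (List.cons a) (listBoundaryₗ R x) := by
  induction x using Finsupp.induction_linear with
  | zero => simp
  | add x y hx hy => simp only [map_add, hx, hy]; abel
  | single l r =>
    simp only [Finsupp.lmapDomain_apply, Finsupp.mapDomain_single,
      Finsupp.linearCombination_single, listBoundary, smul_sub, Finsupp.smul_single, smul_eq_mul,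
      mul_one, Finsupp.mapDomain_smul]

theorem listPrismₗ_cons (f g : V → W) (a : V) (x : List V →₀ R) :
    listPrismₗ R f g (Finsupp.lmapDomain R R (List.cons a) x) =
      Finsupp.lmapDomain R R (List.cons (f a)) (Finsupp.lmapDomain R R (List.cons (g a))
        (Finsupp.lmapDomain R R (List.map g) x)) -
      Finsupp.lmapDomain R R (List.cons (f a)) (listPrismₗ R f g x) := by
  induction x using Finsupp.induction_linear with
  | zero => simp
  | add x y hx hy => simp only [map_add, hx, hy]; abel
  | single l r =>
    simp only [Finsupp.lmapDomain_apply, Finsupp.mapDomain_single,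
      Finsupp.linearCombination_single, listPrism, smul_sub, Finsupp.smul_single, smul_eq_mul,
      mul_one, Finsupp.mapDomain_smul]

theorem listBoundary_map (g : V → W) (l : List V) :
    listBoundary R (l.map g) = Finsupp.lmapDomain R R (List.map g) (listBoundary R l) := by
  induction l with
  | nil => simp [listBoundary]
  | cons a l ih =>
    simp only [List.map_cons, listBoundary, ih, map_sub, Finsupp.lmapDomain_apply,
      Finsupp.mapDomain_single, ← Finsupp.mapDomain_comp]
    rfl

/-- The prism is a chain homotopy between the maps induced by `f` and `g`. -/
theorem listBoundaryₗ_listPrism (f g : V → W) (l : List V) :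
    listBoundaryₗ R (listPrism R f g l) + listPrismₗ R f g (listBoundary R l) =
      Finsupp.single (l.map g) 1 - Finsupp.single (l.map f) 1 := by
  induction l with
  | nil => simp [listPrism, listBoundary]
  | cons a l ih =>
    rw [listPrism, listBoundary, map_sub, map_sub, listBoundaryₗ_cons, listPrismₗ_cons,
      Finsupp.linearCombination_single, Finsupp.linearCombination_single, one_smul, one_smul]
    have := congrArg (Finsupp.lmapDomain R R (List.cons (f a))) ih
    rw [map_add, map_sub] at this
    simp only [listBoundary, map_sub, listBoundary_map, List.map_cons]
    simp only [Finsupp.lmapDomain_apply, Finsupp.mapDomain_single] at this ⊢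
    rw [eq_sub_iff_add_eq] at this ⊢
    rw [← this]
    abel

variable (R) in
/-- The span of the lists that satisfy `p`. -/
noncomputable def listSpan (p : List V → Prop) : Submodule R (List V →₀ R) :=
  Submodule.span R ((fun l => Finsupp.single l 1) '' {l | p l})

theorem single_mem_listSpan {p : List V → Prop} {l : List V} (h : p l) :
    Finsupp.single l 1 ∈ listSpan R p :=
  Submodule.subset_span ⟨l, h, rfl⟩

theorem cons_mem_listSpan {p q : List V → Prop} {a : V} (h : ∀ l, p l → q (a :: l))
    {x : List V →₀ R} (hx : x ∈ listSpan R p) :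
    Finsupp.lmapDomain R R (List.cons a) x ∈ listSpan R q := by
  refine (Submodule.span_le (p := (listSpan R q).comap _)).2 ?_ hx
  rintro _ ⟨l, hl, rfl⟩
  simpa using single_mem_listSpan (R := R) (h l hl)

theorem eq_of_mem_listSpan {M : Type*} [AddCommGroup M] [Module R M] {p : List V → Prop}
    {φ ψ : (List V →₀ R) →ₗ[R] M}
    (h : ∀ l, p l → φ (Finsupp.single l 1) = ψ (Finsupp.single l 1))
    {x : List V →₀ R} (hx : x ∈ listSpan R p) : φ x = ψ x := by
  refine (Submodule.span_le (p := LinearMap.eqLocus φ ψ)).2 ?_ hx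
  rintro _ ⟨l, hl, rfl⟩
  exact h l hl

/-- Prisms on chains consist of chains, if `f` and `g` are monotone and `f ≤ g`. The initial
entry is recorded in order to make the induction work. -/
theorem listPrism_mem_chains {r : V → V → Prop} {s : W → W → Prop} {f g : V → W}
    (hf : ∀ a b, r a b → s (f a) (f b)) (hg : ∀ a b, r a b → s (g a) (g b))
    (hfg : ∀ a, s (f a) (g a)) (a : V) (l : List V) (h : (a :: l).IsChain r) :
    listPrism R f g (a :: l) ∈ listSpan R fun l' : List W =>
      l'.IsChain s ∧ l'.length = l.length + 2 ∧ l'.head? = some (f a) := by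
  induction l generalizing a with
  | nil => simpa [listPrism] using single_mem_listSpan (by simp [hfg])
  | cons b l ih =>
    rw [listPrism]
    refine sub_mem (single_mem_listSpan ⟨?_, by simp, by simp⟩)
      (cons_mem_listSpan ?_ (ih b (List.isChain_cons_cons.1 h).2))
    · refine List.isChain_cons_cons.2 ⟨hfg a, ?_⟩
      rw [← List.map_cons, List.isChain_map]
      exact h.imp fun x y => hg x y
    · rintro (_ | ⟨c, l'⟩) ⟨h1, h2, h3⟩
      · simp at h3
      · obtain rfl : c = f b := by simpa using h3
        refine ⟨List.isChain_cons_cons.2 ⟨hf _ _ (List.isChain_cons_cons.1 h).1, h1⟩, ?_, rfl⟩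
        simpa using h2

/-- Prisms on degenerate lists are degenerate. -/
theorem listPrism_mem_degenerate {f g : V → W} (l : List V) (h : ¬ l.IsChain (· ≠ ·)) :
    listPrism R f g l ∈ listSpan R fun l' : List W => ¬ l'.IsChain (· ≠ ·) := by
  have hcons (a : W) (l : List W) (h : ¬ l.IsChain (· ≠ ·)) : ¬ (a :: l).IsChain (· ≠ ·) :=
    fun h' => h h'.of_cons
  have hmap (l : List V) (h : ¬ l.IsChain (· ≠ ·)) : ¬ (l.map g).IsChain (· ≠ ·) := by
    rw [List.isChain_map]
    exact fun h' => h (h'.imp fun x y hxy e => hxy (congrArg g e))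
  induction l with
  | nil => simp at h
  | cons a l ih =>
    rw [listPrism]
    refine sub_mem (single_mem_listSpan (hcons _ _ (hmap (a :: l) h))) ?_
    cases l with
    | nil => simp at h
    | cons b l =>
      by_cases hl : (b :: l).IsChain (· ≠ ·)
      · -- The only repetition is in front; it makes the first term `f a :: g a :: g a :: _`
        -- degenerate, and all others start with `f a` twice.
        obtain rfl : a = b := by
          by_contra hab
          exact h (List.isChain_cons_cons.2 ⟨hab, hl⟩)
        rw [listPrism, map_sub, Finsupp.lmapDomain_apply, Finsupp.mapDomain_single]
        refine sub_mem (single_mem_listSpan (by simp)) ?_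
        rw [← LinearMap.comp_apply, ← Finsupp.lmapDomain_comp]
        have : ∀ x : List W →₀ R, Finsupp.lmapDomain R R (List.cons (f a) ∘ List.cons (f a)) x ∈
            listSpan R fun l' : List W => ¬ l'.IsChain (· ≠ ·) := by
          intro x
          induction x using Finsupp.induction_linear with
          | zero => simp
          | add x y hx hy => rw [map_add]; exact add_mem hx hy
          | single l r =>
            rw [Finsupp.lmapDomain_apply, Finsupp.mapDomain_single, ← mul_one r, ← smul_eq_mul,
              ← Finsupp.smul_single]
            exact Submodule.smul_mem _ _ (single_mem_listSpan (by simp))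
        exact this _
      · exact cons_mem_listSpan (hcons _) (ih hl)

/-- The adjacency conditions on a list and on a tuple agree. -/
theorem isChain_ofFn_iff {r : V → V → Prop} {k : ℕ} (v : Fin (k + 1) → V) :
    (List.ofFn v).IsChain r ↔ ∀ j : Fin k, r (v j.castSucc) (v j.succ) := by
  rw [List.isChain_iff_getElem]
  constructor
  · intro h j
    have := h j (by simp)
    rw [List.getElem_ofFn, List.getElem_ofFn] at this
    exact this
  · intro h j hj
    rw [List.getElem_ofFn, List.getElem_ofFn]
    exact h ⟨j, by simpa using hj⟩

theorem listBoundary_ofFn {k : ℕ} (v : Fin (k + 1) → V) :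
    listBoundary R (List.ofFn v) =
      ∑ j : Fin (k + 1), (-1 : R) ^ (j : ℕ) • Finsupp.single (List.ofFn (v ∘ j.succAbove)) 1 := by
  induction k with
  | zero => simp [listBoundary]
  | succ k ih =>
    rw [List.ofFn_succ, listBoundary, ih, Fin.sum_univ_succ (n := k + 1), sub_eq_add_neg, map_sum,
      ← Finset.sum_neg_distrib]
    congr 1
    · simp only [Fin.val_zero, pow_zero, one_smul]
      rfl
    · refine Finset.sum_congr rfl fun j _ => ?_
      rw [map_smul, Finsupp.lmapDomain_apply, Finsupp.mapDomain_single, Fin.val_succ, pow_succ,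
        mul_neg_one, neg_smul, List.ofFn_succ (f := v ∘ j.succ.succAbove)]
      simp [Function.comp_def]

end Lists

/-! ### Comparable maps are chain homotopic -/

section Homotopy

variable (R : Type w) [CommRing R] {G H : DiGraph.{u}}

/-- The chain of degree `k` represented by a formal sum of lists; lists of length other than `k + 1`
are sent to zero. -/
noncomputable def ofLists (G : DiGraph.{u}) (k : ℕ) : (List G.V →₀ R) →ₗ[R] G.Chains R k :=
  Finsupp.linearCombination R fun l =>
    if h : l.length = k + 1 then G.gen R fun i => l.get (i.cast h.symm) else 0

variable {R}

theorem ofLists_ofFn {k : ℕ} (v : Fin (k + 1) → G.V) :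
    ofLists R G k (Finsupp.single (List.ofFn v) 1) = G.gen R v := by
  rw [ofLists, Finsupp.linearCombination_single, one_smul, dif_pos (by simp)]
  simp [-List.ofFn_succ]

theorem exists_ofFn_of_length {V : Type u} {k : ℕ} {l : List V} (h : l.length = k + 1) :
    ∃ v : Fin (k + 1) → V, l = List.ofFn v :=
  ⟨fun i => l.get (i.cast h.symm), by
    apply List.ext_get <;> simp [-List.ofFn_succ, h]⟩

theorem ofLists_degenerate {k : ℕ} {x : List G.V →₀ R}
    (hx : x ∈ listSpan R fun l' : List G.V => ¬ l'.IsChain (· ≠ ·)) : ofLists R G k x = 0 := by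
  refine eq_of_mem_listSpan (ψ := 0) (fun l hl => ?_) hx
  by_cases h : l.length = k + 1
  · obtain ⟨v, rfl⟩ := exists_ofFn_of_length h
    rw [ofLists_ofFn]
    rw [isChain_ofFn_iff] at hl
    push Not at hl
    obtain ⟨p, hp⟩ := hl
    exact gen_of_eq p hp
  · rw [ofLists, Finsupp.linearCombination_single, dif_neg h, smul_zero, LinearMap.zero_apply]

/-- Omitting degenerate terms is compatible with the boundary, on lists in which each entry reaches
the next. -/
theorem boundary_ofLists {k : ℕ} {x : List G.V →₀ R}
    (hx : x ∈ listSpan R fun l : List G.V => l.IsChain G.Reach ∧ l.length = k + 2) :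
    G.boundary R k (ofLists R G (k + 1) x) = ofLists R G k (listBoundaryₗ R x) := by
  refine eq_of_mem_listSpan (φ := G.boundary R k ∘ₗ ofLists R G (k + 1))
    (ψ := ofLists R G k ∘ₗ listBoundaryₗ R) (fun l ⟨hl, h⟩ => ?_) hx
  obtain ⟨v, rfl⟩ := exists_ofFn_of_length h
  have hv : G.IsChain v := (isChain_ofFn_iff v).1 hl
  rw [LinearMap.comp_apply, LinearMap.comp_apply, ofLists_ofFn, boundary_gen hv,
    Finsupp.linearCombination_single, one_smul, listBoundary_ofFn, map_sum]
  simp only [map_smul, ofLists_ofFn]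

variable (R) in
/-- The prism operator on reachability chains. -/
noncomputable def prism (f g : G ⟶ H) (k : ℕ) : G.Chains R k →ₗ[R] H.Chains R (k + 1) :=
  Finsupp.linearCombination R fun v =>
    ofLists R H (k + 1) (listPrism R f.toFun g.toFun (List.ofFn v.1))

theorem prism_gen (f g : G ⟶ H) {k : ℕ} {v : Fin (k + 1) → G.V} (hv : G.IsChain v) :
    prism R f g k (G.gen R v) =
      ofLists R H (k + 1) (listPrism R f.toFun g.toFun (List.ofFn v)) := by
  rcases hv.regular_or with h | ⟨p, hp⟩
  · simp [prism, gen_of_isRegular h]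
  · rw [gen_of_eq p hp, map_zero, ofLists_degenerate]
    apply listPrism_mem_degenerate
    rw [isChain_ofFn_iff]
    push Not
    exact ⟨p, hp⟩

theorem boundary_prism_gen (f g : G ⟶ H) (hfg : ∀ v, H.Reach (f.toFun v) (g.toFun v)) {k : ℕ}
    {v : Fin (k + 1) → G.V} (hv : G.IsChain v) :
    H.boundary R k (prism R f g k (G.gen R v)) =
      H.gen R (g.toFun ∘ v) - H.gen R (f.toFun ∘ v) -
        ofLists R H k (listPrismₗ R f.toFun g.toFun (listBoundary R (List.ofFn v))) := by
  rw [prism_gen f g hv, boundary_ofLists, eq_sub_iff_add_eq, ← map_add, listBoundaryₗ_listPrism,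
    map_sub, List.map_ofFn, List.map_ofFn, ofLists_ofFn, ofLists_ofFn]
  have := listPrism_mem_chains (R := R) (r := G.Reach) (s := H.Reach)
    (fun _ _ => Hom.map_reach f) (fun _ _ => Hom.map_reach g) hfg
    (v 0) (List.ofFn fun i => v i.succ) (by rw [← List.ofFn_succ]; exact (isChain_ofFn_iff v).2 hv)
  rw [← List.ofFn_succ] at this
  refine Submodule.span_mono ?_ this
  rintro _ ⟨l, ⟨h1, h2, -⟩, rfl⟩
  exact ⟨l, ⟨h1, by simpa using h2⟩, rfl⟩

theorem chains_hom_ext {M : Type*} [AddCommGroup M] [Module R M] {k : ℕ}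
    {φ ψ : G.Chains R k →ₗ[R] M}
    (h : ∀ v : Fin (k + 1) → G.V, G.IsRegular v → φ (G.gen R v) = ψ (G.gen R v)) : φ = ψ := by
  refine Finsupp.lhom_ext' fun v => LinearMap.ext_ring ?_
  simpa [gen_of_isRegular v.2] using h v.1 v.2

theorem boundary_comp_prism_zero (f g : G ⟶ H) (hfg : ∀ v, H.Reach (f.toFun v) (g.toFun v)) :
    H.boundary R 0 ∘ₗ prism R f g 0 = chainsMap R g 0 - chainsMap R f 0 := by
  refine chains_hom_ext fun v hv => ?_
  rw [LinearMap.comp_apply, boundary_prism_gen f g hfg hv.isChain, LinearMap.sub_apply,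
    chainsMap_gen _ hv.isChain, chainsMap_gen _ hv.isChain]
  simp [listBoundary, listPrism]

theorem boundary_comp_prism_succ (f g : G ⟶ H) (hfg : ∀ v, H.Reach (f.toFun v) (g.toFun v))
    (k : ℕ) :
    prism R f g k ∘ₗ G.boundary R k + H.boundary R (k + 1) ∘ₗ prism R f g (k + 1) =
      chainsMap R g (k + 1) - chainsMap R f (k + 1) := by
  refine chains_hom_ext fun v hv => ?_
  rw [LinearMap.add_apply, LinearMap.comp_apply, LinearMap.comp_apply,
    boundary_prism_gen f g hfg hv.isChain, LinearMap.sub_apply,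
    chainsMap_gen _ hv.isChain, chainsMap_gen _ hv.isChain, boundary_gen hv.isChain,
    listBoundary_ofFn]
  simp only [map_sum, map_smul, prism_gen f g (hv.isChain.face _),
    Finsupp.linearCombination_single, one_smul]
  abel

theorem RC_d (G : DiGraph.{u}) (k : ℕ) :
    ((RC R).obj G).d (k + 1) k = ModuleCat.ofHom (G.boundary R k) := by
  simp only [RC, RCobj, ChainComplex.of_d]

/-- Maps `f ≤ g` for the reachability preorder are chain homotopic. -/
theorem homologyMap_eq_of_reach (f g : G ⟶ H) (hfg : ∀ v, H.Reach (f.toFun v) (g.toFun v))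
    (n : ℕ) :
    HomologicalComplex.homologyMap ((RC R).map f) n =
      HomologicalComplex.homologyMap ((RC R).map g) n := by
  let h : ∀ i j, (ComplexShape.down ℕ).Rel j i → (((RC R).obj G).X i ⟶ ((RC R).obj H).X j) :=
    fun i j hij => by
      obtain rfl : i + 1 = j := hij
      exact ModuleCat.ofHom (prism R f g i)
  have e : (RC R).map g - (RC R).map f = Homotopy.nullHomotopicMap' h := by
    ext k : 1
    cases k with
    | zero =>
      rw [Homotopy.nullHomotopicMap'_f_of_not_rel_left (k₁ := 1) (k₀ := 0) rfl (by simp), RC_d]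
      exact (congrArg ModuleCat.ofHom (boundary_comp_prism_zero (R := R) f g hfg)).symm
    | succ k =>
      rw [Homotopy.nullHomotopicMap'_f (k₂ := k + 2) (k₁ := k + 1) (k₀ := k) rfl rfl, RC_d, RC_d]
      exact (congrArg ModuleCat.ofHom (boundary_comp_prism_succ (R := R) f g hfg k)).symm
  exact ((Homotopy.equivSubZero.symm
    ((Homotopy.ofEq e).trans (Homotopy.nullHomotopy' h))).homologyMap_eq n).symm

end Homotopy

/-! ### Injective maps and the reachability graph -/

section Injective

variable (R : Type w) [CommRing R] {G H : DiGraph.{u}}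

theorem IsRegular.map_of_injective {f : G ⟶ H} (hf : Function.Injective f.toFun) {k : ℕ}
    {v : Fin (k + 1) → G.V} (hv : G.IsRegular v) : H.IsRegular (f.toFun ∘ v) :=
  fun j => ⟨fun e => (hv j).1 (hf e), Hom.map_reach f (hv j).2⟩

theorem chainsMap_injective {f : G ⟶ H} (hf : Function.Injective f.toFun) (k : ℕ) :
    Function.Injective (chainsMap R f k) := by
  let φ : G.RegTuple k → H.RegTuple k := fun v => ⟨f.toFun ∘ v.1, v.2.map_of_injective hf⟩
  have hφ : Function.Injective φ := fun v w h =>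
    Subtype.ext (hf.comp_left (congrArg Subtype.val h))
  have : chainsMap R f k = Finsupp.lmapDomain R R φ :=
    chains_hom_ext fun v hv => by
      rw [chainsMap_gen f hv.isChain, gen_of_isRegular hv, Finsupp.lmapDomain_apply,
        Finsupp.mapDomain_single, gen_of_isRegular (hv.map_of_injective hf)]
  rw [this]
  exact Finsupp.mapDomain_injective hφ

/-- The chains are spanned by the generators. -/
theorem mem_of_gen_mem {k : ℕ} (N : Submodule R (G.Chains R k))
    (h : ∀ v : Fin (k + 1) → G.V, G.IsRegular v → G.gen R v ∈ N) (x : G.Chains R k) : x ∈ N := by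
  have : N.mkQ = 0 := chains_hom_ext fun v hv => by simpa using h v hv
  rw [← N.ker_mkQ, this]
  trivial

theorem mono_RC_map {f : G ⟶ H} (hf : Function.Injective f.toFun) : Mono ((RC R).map f) := by
  have (k : ℕ) : Mono (((RC R).map f).f k) :=
    (ModuleCat.mono_iff_injective _).2 (chainsMap_injective R hf k)
  exact HomologicalComplex.mono_of_mono_f _ inferInstance

/-- The graph with the same vertices as `G` and an edge for each path of `G`. -/
def reachGraph (G : DiGraph.{u}) : DiGraph.{u} := ⟨G.V, ⟨G.Reach⟩⟩

theorem reachGraph_reach {a b : G.V} : G.reachGraph.Reach a b ↔ G.Reach a b := by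
  refine ⟨fun h => ?_, fun h => Relation.ReflTransGen.single h⟩
  induction h with
  | refl => exact Relation.ReflTransGen.refl
  | tail _ e ih => exact ih.trans e

/-- The canonical map from a graph to its reachability graph, the identity on vertices. -/
def toReachGraph (G : DiGraph.{u}) : G ⟶ G.reachGraph :=
  ⟨id, fun _ _ h => Or.inr (Relation.ReflTransGen.single h)⟩

/-- The map of reachability graphs induced by a map of graphs. -/
def reachGraphMap (f : G ⟶ H) : G.reachGraph ⟶ H.reachGraph :=
  ⟨f.toFun, fun _ _ h => Or.inr (Hom.map_reach f h)⟩

/-- The reachability complex only depends on the reachability preorder. -/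
instance (G : DiGraph.{u}) : IsIso ((RC R).map G.toReachGraph) := by
  have (k : ℕ) : IsIso (((RC R).map G.toReachGraph).f k) := by
    rw [ConcreteCategory.isIso_iff_bijective]
    refine ⟨chainsMap_injective R Function.injective_id k, ?_⟩
    intro x
    refine mem_of_gen_mem R (LinearMap.range (chainsMap R G.toReachGraph k)) (fun v hv => ?_) x
    exact ⟨G.gen R v, chainsMap_gen G.toReachGraph fun j => reachGraph_reach.1 (hv j).2⟩
  exact HomologicalComplex.Hom.isIso_of_components _

/-- The short exact sequence defining the relative reachability complex. -/
noncomputable abbrev relSeq (f : G ⟶ H) :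
    ShortComplex (ChainComplex (ModuleCat.{max u w} R) ℕ) :=
  ShortComplex.mk ((RC R).map f) (cokernel.π ((RC R).map f)) (cokernel.condition _)

theorem relSeq_shortExact {f : G ⟶ H} (hf : Function.Injective f.toFun) :
    (relSeq R f).ShortExact := by
  have := mono_RC_map R hf
  exact { exact := ShortComplex.exact_cokernel _ }

end Injective

/-! ### Coreflective subgraphs -/

section Coreflective

variable {A X : DiGraph.{u}}

/-- An injective map that identifies `A` with a subset of the preorder of `X` which is
coreflective in its upward closure: each element of the upward closure has a largest
element of `A` below it. -/
structure IsCoreflective (s : A ⟶ X) : Prop where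
  injective : Function.Injective s.toFun
  reach_of_map : ∀ {a b : A.V}, X.Reach (s.toFun a) (s.toFun b) → A.Reach a b
  exists_retract : ∀ x : X.V, (∃ a : A.V, X.Reach (s.toFun a) x) →
    ∃ p : A.V, ∀ a : A.V, X.Reach (s.toFun a) x ↔ X.Reach (s.toFun a) (s.toFun p)

theorem IsLongCofibration.mem_range {i : A ⟶ X} (hi : IsLongCofibration i) {x : X.V} {a : A.V}
    (h : X.Reach x (i.toFun a)) : x ∈ Set.range i.toFun :=
  by_contra fun hx => hi.not_reach x hx a h

/-- Paths of `X` between vertices of `A` are paths of `A`, because the vertices on the way reach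
`A`. -/
theorem IsLongCofibration.isCoreflective {i : A ⟶ X} (hi : IsLongCofibration i) :
    IsCoreflective i where
  injective := hi.injective
  reach_of_map {a b} h := by
    generalize hy : i.toFun a = y at h
    induction h using Relation.ReflTransGen.head_induction_on generalizing a with
    | refl => rw [hi.injective hy]; exact Relation.ReflTransGen.refl
    | head e h ih =>
      obtain ⟨c, rfl⟩ := hi.mem_range h
      subst hy
      exact (ih rfl).head ((hi.edge_iff _ _).2 e)
  exists_retract := hi.exists_retract

/-- The induced subgraph on the vertices that admit a path from the image of `s`. -/
def upClosure (s : A ⟶ X) : DiGraph.{u} :=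
  ⟨{x : X.V // ∃ a, X.Reach (s.toFun a) x}, ⟨fun x y => X.Edge x.1 y.1⟩⟩

/-- The inclusion of the upward closure. -/
def upClosureIncl (s : A ⟶ X) : upClosure s ⟶ X := ⟨Subtype.val, fun _ _ h => Or.inr h⟩

/-- The map to the upward closure. -/
def toUpClosure (s : A ⟶ X) : A ⟶ upClosure s :=
  ⟨fun a => ⟨s.toFun a, a, Relation.ReflTransGen.refl⟩, fun a b h => by
    rcases s.map_edge a b h with h | h
    · exact Or.inl (Subtype.ext h)
    · exact Or.inr h⟩

theorem upClosure_reach {s : A ⟶ X} {x y : (upClosure s).V} :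
    (upClosure s).Reach x y ↔ X.Reach x.1 y.1 := by
  refine ⟨Hom.map_reach (upClosureIncl s), fun h => ?_⟩
  obtain ⟨y, hy⟩ := y
  change X.Reach x.1 y at h
  induction h with
  | refl => exact Relation.ReflTransGen.refl
  | @tail b c h e ih =>
    have hb : ∃ a, X.Reach (s.toFun a) b := x.2.imp fun a ha => ha.trans h
    exact (ih hb).tail e

/-- The coreflector is monotone, but it need not preserve edges. It becomes a map of graphs when `A`
is replaced by its reachability graph. -/
theorem IsCoreflective.exists_coreflector {s : A ⟶ X} (hs : IsCoreflective s) :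
    ∃ r : upClosure s ⟶ A.reachGraph,
      (∀ a, A.reachGraph.Reach a (r.toFun ((toUpClosure s).toFun a))) ∧
      ∀ x, X.Reach (s.toFun (r.toFun x)) x.1 := by
  choose p hp using fun x : (upClosure s).V => hs.exists_retract x.1 x.2
  have hle (x) : X.Reach (s.toFun (p x)) x.1 := (hp x _).2 Relation.ReflTransGen.refl
  refine ⟨⟨p, fun x y h => Or.inr ?_⟩, fun a => ?_, hle⟩
  · exact hs.reach_of_map ((hp y _).1 ((hle x).tail h))
  · exact reachGraph_reach.2 (hs.reach_of_map ((hp _ a).1 Relation.ReflTransGen.refl))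

/-- The coreflector is a homotopy inverse of the inclusion into the upward closure, up to
the identification of the complexes of a graph and of its reachability graph. -/
theorem IsCoreflective.quasiIso (R : Type w) [CommRing R] {s : A ⟶ X} (hs : IsCoreflective s) :
    QuasiIso ((RC R).map (toUpClosure s)) := by
  obtain ⟨r, hr1, hr2⟩ := hs.exists_coreflector
  rw [quasiIso_iff]
  intro n
  rw [quasiIsoAt_iff_isIso_homologyMap]
  have h1 := homologyMap_eq_of_reach (R := R) A.toReachGraph (toUpClosure s ≫ r) hr1 n
  have h2 := homologyMap_eq_of_reach (R := R) (r ≫ reachGraphMap (toUpClosure s))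
    (upClosure s).toReachGraph (fun x => reachGraph_reach.2 (upClosure_reach.2 (hr2 x))) n
  rw [Functor.map_comp, HomologicalComplex.homologyMap_comp] at h1 h2
  have i1 : IsIso (HomologicalComplex.homologyMap ((RC R).map (toUpClosure s)) n ≫
      HomologicalComplex.homologyMap ((RC R).map r) n) := by
    rw [← h1]; infer_instance
  have i2 : IsIso (HomologicalComplex.homologyMap ((RC R).map r) n ≫
      HomologicalComplex.homologyMap ((RC R).map (reachGraphMap (toUpClosure s))) n) := by
    rw [h2]; infer_instance
  -- The two composites show that `r` induces an isomorphism, and therefore so does the inclusion.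
  have : Mono (HomologicalComplex.homologyMap ((RC R).map r) n) := mono_of_mono _
    (HomologicalComplex.homologyMap ((RC R).map (reachGraphMap (toUpClosure s))) n)
  have : Epi (HomologicalComplex.homologyMap ((RC R).map r) n) :=
    epi_of_epi (HomologicalComplex.homologyMap ((RC R).map (toUpClosure s)) n) _
  have : IsIso (HomologicalComplex.homologyMap ((RC R).map r) n) := isIso_of_mono_of_epi _
  exact IsIso.of_isIso_comp_right _ (HomologicalComplex.homologyMap ((RC R).map r) n)

end Coreflective

/-! ### Pushouts along long cofibrations -/

section Pushout

variable {A X Y Z : DiGraph.{u}} {i : A ⟶ X} {f : A ⟶ Y}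

@[ext]
theorem hom_ext {G H : DiGraph.{u}} {p q : G ⟶ H} (h : ∀ v, p.toFun v = q.toFun v) : p = q :=
  Hom.ext (funext h)

theorem comp_toFun {G H K : DiGraph.{u}} (p : G ⟶ H) (q : H ⟶ K) (v : G.V) :
    (p ≫ q).toFun v = q.toFun (p.toFun v) := rfl

open Classical in
/-- The vertex of the glued graph that corresponds to a vertex of `X`. A vertex of `A` is sent to
the image under `f` of a chosen preimage, which is the only one if `i` is injective. -/
noncomputable def glueFun (i : A ⟶ X) (f : A ⟶ Y) (x : X.V) :
    Y.V ⊕ {x : X.V // x ∉ Set.range i.toFun} :=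
  if h : x ∈ Set.range i.toFun then Sum.inl (f.toFun h.choose) else Sum.inr ⟨x, h⟩

/-- The pushout of `i` and `f` for injective `i`: its vertices are those of `Y` and those of `X`
outside of `A`, and its edges are the images of the edges of `X` and of `Y`. -/
noncomputable def glue (i : A ⟶ X) (f : A ⟶ Y) : DiGraph.{u} :=
  ⟨Y.V ⊕ {x : X.V // x ∉ Set.range i.toFun}, ⟨fun v w =>
    (∃ a b, X.Edge a b ∧ glueFun i f a = v ∧ glueFun i f b = w) ∨
      ∃ a b, Y.Edge a b ∧ Sum.inl a = v ∧ Sum.inl b = w⟩⟩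

/-- The structure map of the glued graph on `X`. -/
noncomputable def glueLeft (i : A ⟶ X) (f : A ⟶ Y) : X ⟶ glue i f :=
  ⟨glueFun i f, fun a b h => Or.inr (Or.inl ⟨a, b, h, rfl, rfl⟩)⟩

/-- The structure map of the glued graph on `Y`. -/
noncomputable def glueRight (i : A ⟶ X) (f : A ⟶ Y) : Y ⟶ glue i f :=
  ⟨Sum.inl, fun a b h => Or.inr (Or.inr ⟨a, b, h, rfl, rfl⟩)⟩

theorem glueFun_of_notMem {x : X.V} (h : x ∉ Set.range i.toFun) :
    glueFun i f x = Sum.inr ⟨x, h⟩ := dif_neg h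

theorem glueFun_apply (hi : Function.Injective i.toFun) (a : A.V) :
    glueFun i f (i.toFun a) = Sum.inl (f.toFun a) := by
  have h : i.toFun a ∈ Set.range i.toFun := ⟨a, rfl⟩
  rw [glueFun, dif_pos h, hi h.choose_spec]

theorem eq_of_glueFun_eq_inr {x : X.V} {y} (h : glueFun i f x = Sum.inr y) : x = y.1 := by
  by_cases hx : x ∈ Set.range i.toFun
  · rw [glueFun, dif_pos hx] at h
    cases h
  · rw [glueFun_of_notMem hx] at h
    rw [← Sum.inr_injective h]

theorem exists_of_glueFun_eq_inl (hi : Function.Injective i.toFun) {x : X.V} {y : Y.V}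
    (h : glueFun i f x = Sum.inl y) : ∃ a, x = i.toFun a ∧ f.toFun a = y := by
  by_cases hx : x ∈ Set.range i.toFun
  · obtain ⟨a, rfl⟩ := hx
    rw [glueFun_apply hi] at h
    exact ⟨a, rfl, Sum.inl_injective h⟩
  · rw [glueFun_of_notMem hx] at h
    cases h

theorem glue_condition (hi : Function.Injective i.toFun) :
    i ≫ glueLeft i f = f ≫ glueRight i f :=
  hom_ext fun a => glueFun_apply hi a

theorem glue_isPushout (hi : Function.Injective i.toFun) :
    IsPushout i f (glueLeft i f) (glueRight i f) := by
  refine ⟨⟨glue_condition hi⟩, ⟨PushoutCocone.IsColimit.mk _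
    (fun s => ⟨Sum.elim s.inr.toFun fun x => s.inl.toFun x.1, ?_⟩) ?_ ?_ ?_⟩⟩
  · have hs (x : X.V) : Sum.elim s.inr.toFun (fun x => s.inl.toFun x.1) (glueFun i f x) =
        s.inl.toFun x := by
      by_cases hx : x ∈ Set.range i.toFun
      · obtain ⟨a, rfl⟩ := hx
        rw [glueFun_apply hi]
        exact (congrArg (fun q : A ⟶ s.pt => q.toFun a) s.condition).symm
      · rw [glueFun_of_notMem hx]
        rfl
    rintro _ _ (⟨a, b, h, rfl, rfl⟩ | ⟨a, b, h, rfl, rfl⟩)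
    · rw [hs, hs]
      exact s.inl.map_edge a b h
    · exact s.inr.map_edge a b h
  · intro s
    ext x
    change Sum.elim s.inr.toFun (fun x => s.inl.toFun x.1) (glueFun i f x) = s.inl.toFun x
    by_cases hx : x ∈ Set.range i.toFun
    · obtain ⟨a, rfl⟩ := hx
      rw [glueFun_apply hi]
      exact (congrArg (fun q : A ⟶ s.pt => q.toFun a) s.condition).symm
    · rw [glueFun_of_notMem hx]
      rfl
  · intro s
    rfl
  · intro s m h1 h2
    ext v
    rcases v with y | x
    · exact congrArg (fun q : Y ⟶ s.pt => q.toFun y) h2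
    · have := congrArg (fun q : X ⟶ s.pt => q.toFun x.1) h1
      change m.toFun (glueFun i f x.1) = _ at this
      rw [glueFun_of_notMem x.2] at this
      exact this

/-- Paths that start outside of `A` and `Y` are paths of `X`. -/
theorem glue_reach_of_inr (hi : IsLongCofibration i) {x : {x : X.V // x ∉ Set.range i.toFun}}
    {v : (glue i f).V} (h : (glue i f).Reach (Sum.inr x) v) :
    ∃ x', v = Sum.inr x' ∧ X.Reach x.1 x'.1 := by
  induction h with
  | refl => exact ⟨x, rfl, Relation.ReflTransGen.refl⟩
  | tail _ e ih =>
    obtain ⟨x', rfl, hx⟩ := ih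
    rcases e with ⟨a, b, h, ha, rfl⟩ | ⟨a, b, h, ha, -⟩
    · obtain rfl := eq_of_glueFun_eq_inr ha
      have hb : b ∉ Set.range i.toFun := by
        rintro ⟨c, rfl⟩
        exact hi.not_reach _ x'.2 c (Relation.ReflTransGen.single h)
      exact ⟨⟨b, hb⟩, glueFun_of_notMem hb, hx.tail h⟩
    · cases ha

/-- Paths that end in `Y` are paths of `Y`: an edge of `X` that ends in `A` is an edge of `A`, and
`f` turns it into an edge or a vertex of `Y`. -/
theorem glue_reach_inl (hi : IsLongCofibration i) {y : Y.V}
    {v : (glue i f).V} (h : (glue i f).Reach v (Sum.inl y)) :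
    ∃ y', v = Sum.inl y' ∧ Y.Reach y' y := by
  induction h using Relation.ReflTransGen.head_induction_on with
  | refl => exact ⟨y, rfl, Relation.ReflTransGen.refl⟩
  | head e _ ih =>
    obtain ⟨y', rfl, hy⟩ := ih
    rcases e with ⟨a, b, h, rfl, hb⟩ | ⟨a, b, h, rfl, hb⟩
    · obtain ⟨b, rfl, rfl⟩ := exists_of_glueFun_eq_inl hi.injective hb
      obtain ⟨a, rfl⟩ := hi.mem_range (Relation.ReflTransGen.single h)
      refine ⟨_, glueFun_apply hi.injective a, ?_⟩
      exact (Hom.map_reach f (Relation.ReflTransGen.single ((hi.edge_iff _ _).2 h))).trans hy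
    · obtain rfl := Sum.inl_injective hb
      exact ⟨a, rfl, hy.head h⟩

/-- A path from `Y` to the complement leaves `Y` through the image of an edge of `X` starting in
`A`. -/
theorem glue_reach_inl_inr (hi : IsLongCofibration i) {y : Y.V}
    {x : {x : X.V // x ∉ Set.range i.toFun}}
    (h : (glue i f).Reach (Sum.inl y) (Sum.inr x)) :
    ∃ a, Y.Reach y (f.toFun a) ∧ X.Reach (i.toFun a) x.1 := by
  generalize hv : (Sum.inl y : (glue i f).V) = v at h
  induction h using Relation.ReflTransGen.head_induction_on generalizing y with
  | refl => cases hv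
  | head e h ih =>
    subst hv
    rcases e with ⟨a, b, e, ha, rfl⟩ | ⟨a, b, e, ha, rfl⟩
    · obtain ⟨a, rfl, rfl⟩ := exists_of_glueFun_eq_inl hi.injective ha
      by_cases hb : b ∈ Set.range i.toFun
      · obtain ⟨b, rfl⟩ := hb
        obtain ⟨c, hc, hcx⟩ := ih (glueFun_apply hi.injective b).symm
        exact ⟨c, (Hom.map_reach f
          (Relation.ReflTransGen.single ((hi.edge_iff _ _).2 e))).trans hc, hcx⟩
      · rw [glueFun_of_notMem hb] at h
        obtain ⟨x', hx', hr⟩ := glue_reach_of_inr hi h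
        obtain rfl := Sum.inr_injective hx'
        exact ⟨a, Relation.ReflTransGen.refl, hr.head e⟩
    · obtain rfl := Sum.inl_injective ha
      obtain ⟨c, hc, hcx⟩ := ih rfl
      exact ⟨c, hc.head e, hcx⟩

/-- A square whose right column is obtained from the left one by replacing `A` by `Y`, on the
level of vertices and of the reachability preorder. -/
structure IsGluing (i : A ⟶ X) (f : A ⟶ Y) (g : X ⟶ Z) (j : Y ⟶ Z) : Prop where
  injective : Function.Injective j.toFun
  exists_preimage : ∀ z, (∃ y, j.toFun y = z) ∨ ∃ x ∉ Set.range i.toFun, g.toFun x = z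
  eq_of_map_eq : ∀ {x x'}, x ∉ Set.range i.toFun → g.toFun x' = g.toFun x → x' = x
  map_ne : ∀ {x}, x ∉ Set.range i.toFun → ∀ y, j.toFun y ≠ g.toFun x
  reach_of_left : ∀ {x z}, x ∉ Set.range i.toFun → Z.Reach (g.toFun x) z →
    ∃ x' ∉ Set.range i.toFun, g.toFun x' = z ∧ X.Reach x x'
  reach_right : ∀ {y z}, Z.Reach z (j.toFun y) → ∃ y', j.toFun y' = z ∧ Y.Reach y' y
  reach_right_left : ∀ {x y}, x ∉ Set.range i.toFun → Z.Reach (j.toFun y) (g.toFun x) →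
    ∃ a, Y.Reach y (f.toFun a) ∧ X.Reach (i.toFun a) x

theorem glue_isGluing (hi : IsLongCofibration i) :
    IsGluing i f (glueLeft i f) (glueRight i f) where
  injective := Sum.inl_injective
  exists_preimage z := by
    rcases z with y | x
    · exact Or.inl ⟨y, rfl⟩
    · exact Or.inr ⟨x.1, x.2, glueFun_of_notMem x.2⟩
  eq_of_map_eq {x x'} hx h := eq_of_glueFun_eq_inr (h.trans (glueFun_of_notMem hx))
  map_ne {x} hx y h := by cases h.trans (glueFun_of_notMem hx)
  reach_of_left {x z} hx h := by
    change (glue i f).Reach (glueFun i f x) z at h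
    rw [glueFun_of_notMem hx] at h
    obtain ⟨x', rfl, hr⟩ := glue_reach_of_inr hi h
    exact ⟨x'.1, x'.2, glueFun_of_notMem x'.2, hr⟩
  reach_right {y z} h := by
    obtain ⟨y', rfl, hr⟩ := glue_reach_inl hi h
    exact ⟨y', rfl, hr⟩
  reach_right_left {x y} hx h := by
    change (glue i f).Reach _ (glueFun i f x) at h
    rw [glueFun_of_notMem hx] at h
    exact glue_reach_inl_inr hi h

/-- The description of a glued square by vertices and reachability is invariant under isomorphism;
one by edges would not be, because isomorphic graphs may differ in their
loops. -/
theorem IsGluing.of_iso {W : DiGraph.{u}} {g : X ⟶ Z} {j : Y ⟶ Z} (h : IsGluing i f g j)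
    (e : Z ≅ W) : IsGluing i f (g ≫ e.hom) (j ≫ e.hom) := by
  have hinv (z : Z.V) : e.inv.toFun (e.hom.toFun z) = z :=
    congrArg (fun q : Z ⟶ Z => q.toFun z) e.hom_inv_id
  have hhom (w : W.V) : e.hom.toFun (e.inv.toFun w) = w :=
    congrArg (fun q : W ⟶ W => q.toFun w) e.inv_hom_id
  have hinj : Function.Injective e.hom.toFun := Function.LeftInverse.injective hinv
  have hreach {w w' : W.V} (hw : W.Reach w w') := Hom.map_reach e.inv hw
  refine ⟨hinj.comp h.injective, fun w => ?_, fun hx hw => h.eq_of_map_eq hx (hinj hw),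
    fun hx y hw => h.map_ne hx y (hinj hw), fun hx hw => ?_, fun hw => ?_, fun hx hw => ?_⟩
  · refine (h.exists_preimage (e.inv.toFun w)).imp ?_ ?_
    · rintro ⟨y, hy⟩
      exact ⟨y, by rw [comp_toFun, hy, hhom]⟩
    · rintro ⟨x, hx, hw⟩
      exact ⟨x, hx, by rw [comp_toFun, hw, hhom]⟩
  · have := hreach hw
    rw [comp_toFun, hinv] at this
    obtain ⟨x', hx', hw', hr⟩ := h.reach_of_left hx this
    exact ⟨x', hx', by rw [comp_toFun, hw', hhom], hr⟩
  · have := hreach hw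
    rw [comp_toFun, hinv] at this
    obtain ⟨y', hw', hr⟩ := h.reach_right this
    exact ⟨y', by rw [comp_toFun, hw', hhom], hr⟩
  · have := hreach hw
    rw [comp_toFun, comp_toFun, hinv, hinv] at this
    exact h.reach_right_left hx this

theorem IsLongCofibration.isGluing (hi : IsLongCofibration i) {g : X ⟶ Z} {j : Y ⟶ Z}
    (sq : IsPushout i f g j) : IsGluing i f g j := by
  have h := (glue_isGluing (f := f) hi).of_iso ((glue_isPushout hi.injective).isoIsPushout _ _ sq)
  simpa using h

/-- The pushout of a long cofibration is coreflective in its upward closure; the coreflector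
sends `g x` to `f (π x)`. -/
theorem IsGluing.isCoreflective {g : X ⟶ Z} {j : Y ⟶ Z} (h : IsGluing i f g j)
    (sq : i ≫ g = f ≫ j) (hi : IsCoreflective i) : IsCoreflective j where
  injective := h.injective
  reach_of_map {a b} hr := by
    obtain ⟨y, hy, hr⟩ := h.reach_right hr
    rwa [← h.injective hy]
  exists_retract z := by
    rintro ⟨y, hy⟩
    rcases h.exists_preimage z with ⟨y', rfl⟩ | ⟨x, hx, rfl⟩
    · exact ⟨y', fun _ => Iff.rfl⟩
    · obtain ⟨a, -, ha⟩ := h.reach_right_left hx hy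
      obtain ⟨p, hp⟩ := hi.exists_retract x ⟨a, ha⟩
      have hsq (b : A.V) : g.toFun (i.toFun b) = j.toFun (f.toFun b) :=
        congrArg (fun q : A ⟶ Z => q.toFun b) sq
      refine ⟨f.toFun p, fun b => ⟨fun hb => ?_, fun hb => ?_⟩⟩
      · obtain ⟨c, hbc, hcx⟩ := h.reach_right_left hx hb
        have := Hom.map_reach g ((hp c).1 hcx)
        rw [hsq, hsq] at this
        exact (Hom.map_reach j hbc).trans this
      · have := Hom.map_reach g ((hp p).2 Relation.ReflTransGen.refl)
        rw [hsq] at this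
        exact hb.trans this

end Pushout

/-! ### Excision -/

section Excision

variable (R : Type w) [CommRing R] {A X Y Z : DiGraph.{u}}

/-- The quotient map from the chains of the ambient graph to the relative chains. -/
noncomputable def relProj (s : A ⟶ X) (k : ℕ) : X.Chains R k →ₗ[R] (relRC R s).X k :=
  ((cokernel.π ((RC R).map s)).f k).hom

theorem relSeq_degreewise {s : A ⟶ X} (hs : Function.Injective s.toFun) (k : ℕ) :
    ((relSeq R s).map (HomologicalComplex.eval _ _ k)).ShortExact :=
  (HomologicalComplex.shortExact_iff_degreewise_shortExact _).1 (relSeq_shortExact R hs) k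

theorem relProj_surjective {s : A ⟶ X} (hs : Function.Injective s.toFun) (k : ℕ) :
    Function.Surjective (relProj R s k) :=
  (relSeq_degreewise R hs k).moduleCat_surjective_g

theorem relProj_eq_zero_iff {s : A ⟶ X} (hs : Function.Injective s.toFun) {k : ℕ}
    {x : X.Chains R k} : relProj R s k x = 0 ↔ x ∈ LinearMap.range (chainsMap R s k) :=
  (ShortComplex.ShortExact.moduleCat_exact_iff_function_exact _).1
    (relSeq_degreewise R hs k).exact x

/-- The map of relative complexes induced by a commutative square. -/
noncomputable abbrev relRCMap {i : A ⟶ X} {j : Y ⟶ Z} (f : A ⟶ Y) (g : X ⟶ Z)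
    (sq : i ≫ g = f ≫ j) : relRC R i ⟶ relRC R j :=
  cokernel.map ((RC R).map i) ((RC R).map j) ((RC R).map f) ((RC R).map g)
    (by rw [← Functor.map_comp, ← Functor.map_comp, sq])

theorem relRCMap_relProj {i : A ⟶ X} {j : Y ⟶ Z} (f : A ⟶ Y) (g : X ⟶ Z)
    (sq : i ≫ g = f ≫ j) (k : ℕ) (x : X.Chains R k) :
    (relRCMap R f g sq).f k (relProj R i k x) = relProj R j k (chainsMap R g k x) := by
  have := congrArg (fun q => q.f k) (cokernel.π_desc ((RC R).map i)
    ((RC R).map g ≫ cokernel.π ((RC R).map j)) (by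
      rw [← Category.assoc, ← Functor.map_comp, sq, Functor.map_comp, Category.assoc,
        cokernel.condition, comp_zero]))
  exact congrArg (fun q => q.hom x) this

theorem upClosureIncl_injective (s : A ⟶ X) : Function.Injective (upClosureIncl s).toFun :=
  Subtype.val_injective

/-- The first entry of a chain of vertices reaches all others. -/
theorem IsChain.reach_zero {G : DiGraph.{u}} {k : ℕ} {v : Fin (k + 1) → G.V} (hv : G.IsChain v)
    (l : Fin (k + 1)) : G.Reach (v 0) (v l) := by
  induction l using Fin.induction with
  | zero => exact Relation.ReflTransGen.refl
  | succ l ih => exact ih.trans (hv l)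

/-- A chain of vertices whose first entry lies in the upward closure lies in it entirely. -/
theorem gen_mem_range_upClosure {s : A ⟶ X} {k : ℕ} {v : Fin (k + 1) → X.V} (hv : X.IsChain v)
    (h : ∃ a, X.Reach (s.toFun a) (v 0)) :
    X.gen R v ∈ LinearMap.range (chainsMap R (upClosureIncl s) k) := by
  let v' : Fin (k + 1) → (upClosure s).V := fun l =>
    ⟨v l, h.imp fun a ha => ha.trans (hv.reach_zero l)⟩
  exact ⟨(upClosure s).gen R v',
    chainsMap_gen (upClosureIncl s) (v := v') fun l => upClosure_reach.2 (hv l)⟩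

variable {i : A ⟶ X} {f : A ⟶ Y} {g : X ⟶ Z} {j : Y ⟶ Z}

theorem reach_of_square (sq : i ≫ g = f ≫ j) {x : X.V} (h : ∃ a, X.Reach (i.toFun a) x) :
    ∃ y, Z.Reach (j.toFun y) (g.toFun x) := by
  obtain ⟨a, ha⟩ := h
  refine ⟨f.toFun a, ?_⟩
  have := Hom.map_reach g ha
  rwa [← comp_toFun, sq] at this

/-- The map of upward closures induced by a commutative square. -/
def upClosureMap (sq : i ≫ g = f ≫ j) : upClosure i ⟶ upClosure j :=
  ⟨fun x => ⟨g.toFun x.1, reach_of_square sq x.2⟩, fun _ _ h =>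
    (g.map_edge _ _ h).imp Subtype.ext id⟩

theorem IsGluing.notMem_range (h : IsGluing i f g j) {x x' : X.V} (hx : x ∉ Set.range i.toFun)
    (hr : X.Reach x x') : x' ∉ Set.range i.toFun := by
  obtain ⟨x'', hx'', hg, -⟩ := h.reach_of_left hx (Hom.map_reach g hr)
  rwa [h.eq_of_map_eq hx'' hg.symm]

/-- Outside the upward closure of `Y`, chains of vertices lift to chains of `X`. -/
theorem IsGluing.exists_lift (h : IsGluing i f g j) {k : ℕ} {w : Fin (k + 1) → Z.V}
    (hw : Z.IsRegular w) (h0 : ¬ ∃ y, Z.Reach (j.toFun y) (w 0)) :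
    ∃ v : Fin (k + 1) → X.V, X.IsRegular v ∧ g.toFun ∘ v = w := by
  rcases h.exists_preimage (w 0) with ⟨y, hy⟩ | ⟨x, hx, hxw⟩
  · exact absurd ⟨y, hy ▸ Relation.ReflTransGen.refl⟩ h0
  choose v hv hvw _ using fun l => h.reach_of_left hx (hxw ▸ hw.isChain.reach_zero l)
  refine ⟨v, fun l => ⟨fun e => (hw l).1 ?_, ?_⟩, funext hvw⟩
  · rw [← hvw, ← hvw, e]
  · have := (hw l).2
    rw [← hvw, ← hvw] at this
    obtain ⟨x', hx', hg, hr⟩ := h.reach_of_left (hv _) this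
    rwa [h.eq_of_map_eq hx' hg.symm]

open Classical in
/-- The partial inverse of `g` on chains: tuples that start outside the upward closure of `Y` are
lifted along `g`, and the others are sent to zero. -/
noncomputable def IsGluing.lift (h : IsGluing i f g j) (k : ℕ) : Z.Chains R k →ₗ[R] X.Chains R k :=
  Finsupp.linearCombination R fun w =>
    if h0 : ∃ y, Z.Reach (j.toFun y) (w.1 0) then 0
    else X.gen R (h.exists_lift w.2 h0).choose

theorem IsGluing.lift_of_reach (h : IsGluing i f g j) {k : ℕ} {w : Fin (k + 1) → Z.V}
    (h0 : ∃ y, Z.Reach (j.toFun y) (w 0)) : h.lift R k (Z.gen R w) = 0 := by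
  by_cases hw : Z.IsRegular w
  · rw [gen_of_isRegular hw, lift, Finsupp.linearCombination_single, dif_pos h0, smul_zero]
  · rw [gen, dif_neg hw, map_zero]

theorem IsGluing.lift_map (h : IsGluing i f g j) {k : ℕ} {v : Fin (k + 1) → X.V}
    (hv : X.IsRegular v) (h0 : ¬ ∃ a, X.Reach (i.toFun a) (v 0)) :
    h.lift R k (Z.gen R (g.toFun ∘ v)) = X.gen R v := by
  have hv0 : v 0 ∉ Set.range i.toFun := by
    rintro ⟨a, ha⟩
    exact h0 ⟨a, ha ▸ Relation.ReflTransGen.refl⟩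
  have hA (l) : v l ∉ Set.range i.toFun := h.notMem_range hv0 (hv.isChain.reach_zero l)
  have hw : Z.IsRegular (g.toFun ∘ v) := fun l =>
    ⟨fun e => (hv l).1 (h.eq_of_map_eq (hA _) e), Hom.map_reach g (hv l).2⟩
  have h0' : ¬ ∃ y, Z.Reach (j.toFun y) (g.toFun (v 0)) := by
    rintro ⟨y, hy⟩
    obtain ⟨a, -, ha⟩ := h.reach_right_left hv0 hy
    exact h0 ⟨a, ha⟩
  rw [gen_of_isRegular hw, lift, Finsupp.linearCombination_single, one_smul]
  refine (dif_neg h0').trans ?_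
  obtain ⟨-, h3⟩ := (h.exists_lift hw h0').choose_spec
  congr 1
  exact funext fun l => h.eq_of_map_eq (hA l) (congrFun h3 l)

theorem IsGluing.lift_comp_incl (h : IsGluing i f g j) (k : ℕ) :
    h.lift R k ∘ₗ chainsMap R (upClosureIncl j) k = 0 := by
  refine chains_hom_ext fun v hv => ?_
  rw [LinearMap.comp_apply, chainsMap_gen _ hv.isChain]
  exact h.lift_of_reach R (v 0).2

theorem IsGluing.sub_lift_map_mem (h : IsGluing i f g j) (sq : i ≫ g = f ≫ j) {k : ℕ}
    (x : X.Chains R k) :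
    x - h.lift R k (chainsMap R g k x) ∈ LinearMap.range (chainsMap R (upClosureIncl i) k) := by
  refine mem_of_gen_mem R ((LinearMap.range (chainsMap R (upClosureIncl i) k)).comap
    (LinearMap.id - h.lift R k ∘ₗ chainsMap R g k)) (fun v hv => ?_) x
  change X.gen R v - h.lift R k (chainsMap R g k (X.gen R v)) ∈
    LinearMap.range (chainsMap R (upClosureIncl i) k)
  rw [chainsMap_gen _ hv.isChain]
  by_cases h0 : ∃ a, X.Reach (i.toFun a) (v 0)
  · rw [h.lift_of_reach R (reach_of_square sq h0), sub_zero]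
    exact gen_mem_range_upClosure R hv.isChain h0
  · rw [h.lift_map R hv h0, sub_self]
    exact zero_mem _

theorem IsGluing.sub_map_lift_mem (h : IsGluing i f g j) (sq : i ≫ g = f ≫ j) {k : ℕ}
    (z : Z.Chains R k) :
    z - chainsMap R g k (h.lift R k z) ∈ LinearMap.range (chainsMap R (upClosureIncl j) k) := by
  refine mem_of_gen_mem R ((LinearMap.range (chainsMap R (upClosureIncl j) k)).comap
    (LinearMap.id - chainsMap R g k ∘ₗ h.lift R k)) (fun w hw => ?_) z
  change Z.gen R w - chainsMap R g k (h.lift R k (Z.gen R w)) ∈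
    LinearMap.range (chainsMap R (upClosureIncl j) k)
  by_cases h0 : ∃ y, Z.Reach (j.toFun y) (w 0)
  · rw [h.lift_of_reach R h0, map_zero, sub_zero]
    exact gen_mem_range_upClosure R hw.isChain h0
  · obtain ⟨v, hv, rfl⟩ := h.exists_lift hw h0
    rw [h.lift_map R hv fun ha => h0 (reach_of_square sq ha), chainsMap_gen _ hv.isChain, sub_self]
    exact zero_mem _

/-- Relative to the upward closures, excision holds on the level of complexes: both relative
complexes are spanned by the tuples that start outside the upward closure. -/
theorem IsGluing.isIso_relRCMap (h : IsGluing i f g j) (sq : i ≫ g = f ≫ j) :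
    IsIso (relRCMap R (i := upClosureIncl i) (j := upClosureIncl j) (upClosureMap sq) g rfl) := by
  have (k : ℕ) : IsIso ((relRCMap R (i := upClosureIncl i) (j := upClosureIncl j)
      (upClosureMap sq) g rfl).f k) := by
    have hc := relRCMap_relProj R (i := upClosureIncl i) (j := upClosureIncl j) (upClosureMap sq)
      g rfl k
    rw [ConcreteCategory.isIso_iff_bijective]
    constructor
    · refine (injective_iff_map_eq_zero _).2 fun x hx => ?_
      obtain ⟨x, rfl⟩ := relProj_surjective R (upClosureIncl_injective i) k x
      rw [hc, relProj_eq_zero_iff R (upClosureIncl_injective j)] at hx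
      rw [relProj_eq_zero_iff R (upClosureIncl_injective i)]
      obtain ⟨y, hy⟩ := hx
      have := h.sub_lift_map_mem R sq x
      have h0 := LinearMap.congr_fun (h.lift_comp_incl R k) y
      rw [LinearMap.comp_apply, LinearMap.zero_apply] at h0
      rwa [← hy, h0, sub_zero] at this
    · intro z
      obtain ⟨z, rfl⟩ := relProj_surjective R (upClosureIncl_injective j) k z
      refine ⟨relProj R (upClosureIncl i) k (h.lift R k z), ?_⟩
      rw [hc, ← sub_eq_zero, ← map_sub,
        relProj_eq_zero_iff R (upClosureIncl_injective j),
        ← neg_mem_iff, neg_sub]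
      exact h.sub_map_lift_mem R sq z
  exact HomologicalComplex.Hom.isIso_of_components _

/-- A coreflective subgraph may be replaced by its upward closure. -/
theorem IsCoreflective.quasiIso_relRCMap {s : A ⟶ X} (hs : IsCoreflective s) :
    QuasiIso (relRCMap R (i := s) (j := upClosureIncl s) (toUpClosure s) (𝟙 X) rfl) := by
  let φ : relSeq R s ⟶ relSeq R (upClosureIncl s) :=
    { τ₁ := (RC R).map (toUpClosure s)
      τ₂ := (RC R).map (𝟙 X)
      τ₃ := relRCMap R (toUpClosure s) (𝟙 X) rfl
      comm₁₂ := by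
        change (RC R).map _ ≫ (RC R).map _ = (RC R).map _ ≫ (RC R).map _
        rw [← Functor.map_comp, ← Functor.map_comp]
        rfl
      comm₂₃ := (cokernel.π_desc _ _ _).symm }
  have h2 : QuasiIso φ.τ₂ := by
    change QuasiIso ((RC R).map (𝟙 X))
    infer_instance
  exact HomologicalComplex.HomologySequence.quasiIso_τ₃ φ (relSeq_shortExact R hs.injective)
    (relSeq_shortExact R (upClosureIncl_injective s)) (hs.quasiIso R) h2

theorem IsGluing.quasiIso_relRCMap (h : IsGluing i f g j) (sq : i ≫ g = f ≫ j)
    (hi : IsCoreflective i) : QuasiIso (relRCMap R f g sq) := by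
  have h1 := hi.quasiIso_relRCMap R
  have h2 := (h.isCoreflective sq hi).quasiIso_relRCMap R
  have h3 := h.isIso_relRCMap R sq
  have e : relRCMap R f g sq ≫
        relRCMap R (i := j) (j := upClosureIncl j) (toUpClosure j) (𝟙 Z) rfl =
      relRCMap R (i := i) (j := upClosureIncl i) (toUpClosure i) (𝟙 X) rfl ≫
        relRCMap R (i := upClosureIncl i) (j := upClosureIncl j) (upClosureMap sq) g rfl := by
    rw [← cancel_epi (cokernel.π ((RC R).map i))]
    simp
  have : QuasiIso (relRCMap R f g sq ≫
      relRCMap R (i := j) (j := upClosureIncl j) (toUpClosure j) (𝟙 Z) rfl) := by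
    rw [e]
    infer_instance
  exact quasiIso_of_comp_right _
    (relRCMap R (i := j) (j := upClosureIncl j) (toUpClosure j) (𝟙 Z) rfl)

theorem IsGluing.excision (h : IsGluing i f g j) (sq : i ≫ g = f ≫ j) (hi : IsCoreflective i)
    (n : ℕ) : Function.Bijective (relRH.map R n f g sq) := by
  have := h.quasiIso_relRCMap R sq hi
  exact (ConcreteCategory.isIso_iff_bijective
    (HomologicalComplex.homologyMap (relRCMap R f g sq) n)).1 inferInstance

end Excision

/-! ### The Mayer–Vietoris sequence -/

section BarrattWhitehead

variable {R : Type w} [CommRing R] {A X P Y Z Q A' Y' : Type*}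
  [AddCommGroup A] [AddCommGroup X] [AddCommGroup P] [AddCommGroup Y] [AddCommGroup Z]
  [AddCommGroup Q] [AddCommGroup A'] [AddCommGroup Y'] [Module R A] [Module R X] [Module R P]
  [Module R Y] [Module R Z] [Module R Q] [Module R A'] [Module R Y']
  {i : A →ₗ[R] X} {p : X →ₗ[R] P} {d : P →ₗ[R] A'} {j : Y →ₗ[R] Z} {q : Z →ₗ[R] Q}
  {d' : Q →ₗ[R] Y'} {f : A →ₗ[R] Y} {g : X →ₗ[R] Z} {f' : A' →ₗ[R] Y'}

/-- The connecting map of the Mayer–Vietoris sequence, `Z → Q ≃ P → A'`. -/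
noncomputable def barrattWhiteheadδ (d : P →ₗ[R] A') (e : P ≃ₗ[R] Q) (q : Z →ₗ[R] Q) :
    Z →ₗ[R] A' := d ∘ₗ e.symm.toLinearMap ∘ₗ q

theorem barrattWhitehead_exact_sum {P₁ Q₁ : Type*} [AddCommGroup P₁] [AddCommGroup Q₁]
    [Module R P₁] [Module R Q₁] {d : P₁ →ₗ[R] A} {d' : Q₁ →ₗ[R] Y} {e : P ≃ₗ[R] Q}
    {e₁ : P₁ ≃ₗ[R] Q₁} (hdi : Function.Exact d i) (hip : Function.Exact i p)
    (hdj : Function.Exact d' j) (hjq : Function.Exact j q) (hif : ∀ a, g (i a) = j (f a))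
    (hpq : ∀ x, q (g x) = e (p x)) (hd : ∀ u, d' (e₁ u) = f (d u)) :
    Function.Exact ((-i).prod f) (g.coprod j) := by
  rintro ⟨x, y⟩
  constructor
  · intro h
    replace h : g x + j y = 0 := h
    obtain ⟨a, rfl⟩ := (hip x).1 <| by
      rw [← e.map_eq_zero_iff, ← hpq, eq_neg_of_add_eq_zero_left h, map_neg,
        hjq.apply_apply_eq_zero, neg_zero]
    rw [hif, ← map_add] at h
    obtain ⟨w, hw⟩ := (hdj _).1 h
    obtain ⟨u, rfl⟩ := e₁.surjective w
    -- `-a` maps to the first component; `d u` corrects the second one without changing the first.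
    refine ⟨d u - a, Prod.ext ?_ ?_⟩
    · change -i (d u - a) = i a
      rw [map_sub, hdi.apply_apply_eq_zero, zero_sub, neg_neg]
    · change f (d u - a) = y
      rw [map_sub, ← hd, hw, add_sub_cancel_left]
  · rintro ⟨a, ha⟩
    obtain ⟨rfl, rfl⟩ := Prod.ext_iff.1 ha
    change g (-i a) + j (f a) = 0
    rw [map_neg, hif, neg_add_cancel]

theorem barrattWhitehead_exact_right {e : P ≃ₗ[R] Q} (hpd : Function.Exact p d)
    (hjq : Function.Exact j q) (hpq : ∀ x, q (g x) = e (p x)) :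
    Function.Exact (g.coprod j) (barrattWhiteheadδ d e q) := by
  intro z
  constructor
  · intro h
    obtain ⟨x, hx⟩ := (hpd _).1 h
    replace hx : p x = e.symm (q z) := hx
    obtain ⟨y, hy⟩ := (hjq (z - g x)).1 <| by
      rw [map_sub, hpq, hx, e.apply_symm_apply, sub_self]
    exact ⟨(x, y), by rw [LinearMap.coprod_apply, hy, add_sub_cancel]⟩
  · rintro ⟨⟨x, y⟩, rfl⟩
    change d (e.symm (q (g x + j y))) = 0
    rw [map_add, hjq.apply_apply_eq_zero, add_zero, hpq, e.symm_apply_apply,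
      hpd.apply_apply_eq_zero]

theorem barrattWhitehead_exact_left {X' : Type*} [AddCommGroup X'] [Module R X']
    {i' : A' →ₗ[R] X'} {e : P ≃ₗ[R] Q} (hdi : Function.Exact d i') (hqd : Function.Exact q d')
    (hd : ∀ u, d' (e u) = f' (d u)) :
    Function.Exact (barrattWhiteheadδ d e q) ((-i').prod f') := by
  intro a
  constructor
  · intro h
    obtain ⟨h1, h2⟩ := Prod.ext_iff.1 h
    replace h1 : -i' a = 0 := h1
    replace h2 : f' a = 0 := h2
    obtain ⟨u, rfl⟩ := (hdi a).1 (neg_eq_zero.1 h1)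
    rw [← hd] at h2
    obtain ⟨z, hz⟩ := (hqd _).1 h2
    refine ⟨z, ?_⟩
    change d (e.symm (q z)) = d u
    rw [hz, e.symm_apply_apply]
  · rintro ⟨z, rfl⟩
    refine Prod.ext ?_ ?_
    · change -i' (d _) = 0
      rw [hdi.apply_apply_eq_zero, neg_zero]
    · change f' (d (e.symm (q z))) = 0
      rw [← hd, e.apply_symm_apply, hqd.apply_apply_eq_zero]

theorem barrattWhitehead_surjective {e : P ≃ₗ[R] Q} (hp : Function.Surjective p)
    (hjq : Function.Exact j q) (hpq : ∀ x, q (g x) = e (p x)) :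
    Function.Surjective (g.coprod j) := by
  intro z
  obtain ⟨x, hx⟩ := hp (e.symm (q z))
  obtain ⟨y, hy⟩ := (hjq (z - g x)).1 <| by
    rw [map_sub, hpq, hx, e.apply_symm_apply, sub_self]
  exact ⟨(x, y), by rw [LinearMap.coprod_apply, hy, add_sub_cancel]⟩

end BarrattWhitehead

section LongExactSequence

variable (R : Type w) [CommRing R] {A X Y Z : DiGraph.{u}}

/-- The map from absolute to relative homology. -/
noncomputable def relRH.proj (s : A ⟶ X) (n : ℕ) : RH R n X →ₗ[R] relRH R n s :=
  (HomologicalComplex.homologyMap (cokernel.π ((RC R).map s)) n).hom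

/-- The connecting map of the long exact sequence of a pair. -/
noncomputable def relRH.δ {s : A ⟶ X} (hs : Function.Injective s.toFun) (n : ℕ) :
    relRH R (n + 1) s →ₗ[R] RH R n A :=
  ((relSeq_shortExact R hs).δ (n + 1) n rfl).hom

theorem relRH.exact_map_proj {s : A ⟶ X} (hs : Function.Injective s.toFun) (n : ℕ) :
    Function.Exact (RH.map R n s) (relRH.proj R s n) :=
  (ShortComplex.ShortExact.moduleCat_exact_iff_function_exact _).1
    ((relSeq_shortExact R hs).homology_exact₂ n)

theorem relRH.exact_proj_δ {s : A ⟶ X} (hs : Function.Injective s.toFun) (n : ℕ) :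
    Function.Exact (relRH.proj R s (n + 1)) (relRH.δ R hs n) :=
  (ShortComplex.ShortExact.moduleCat_exact_iff_function_exact _).1
    ((relSeq_shortExact R hs).homology_exact₃ (n + 1) n rfl)

theorem relRH.exact_δ_map {s : A ⟶ X} (hs : Function.Injective s.toFun) (n : ℕ) :
    Function.Exact (relRH.δ R hs n) (RH.map R n s) :=
  (ShortComplex.ShortExact.moduleCat_exact_iff_function_exact _).1
    ((relSeq_shortExact R hs).homology_exact₁ (n + 1) n rfl)

theorem relRH.proj_zero_surjective (s : A ⟶ X) : Function.Surjective (relRH.proj R s 0) := by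
  have := HomologicalComplex.epi_homologyMap_of_epi_of_not_rel (cokernel.π ((RC R).map s)) 0
    (by simp)
  exact (ModuleCat.epi_iff_surjective _).1 this

variable {i : A ⟶ X} {f : A ⟶ Y} {g : X ⟶ Z} {j : Y ⟶ Z}

theorem relRH.proj_map (sq : i ≫ g = f ≫ j) (n : ℕ) (x : RH R n X) :
    relRH.proj R j n (RH.map R n g x) = relRH.map R n f g sq (relRH.proj R i n x) := by
  have : (RC R).map g ≫ cokernel.π ((RC R).map j) =
      cokernel.π ((RC R).map i) ≫ relRCMap R f g sq := (cokernel.π_desc _ _ _).symm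
  have := congrArg (fun q => HomologicalComplex.homologyMap q n) this
  simp only [HomologicalComplex.homologyMap_comp] at this
  exact congrArg (fun q => q.hom x) this

theorem relRH.δ_map (sq : i ≫ g = f ≫ j) (hi : Function.Injective i.toFun)
    (hj : Function.Injective j.toFun) (n : ℕ) (x : relRH R (n + 1) i) :
    relRH.δ R hj n (relRH.map R (n + 1) f g sq x) = RH.map R n f (relRH.δ R hi n x) := by
  let φ : relSeq R i ⟶ relSeq R j :=
    { τ₁ := (RC R).map f
      τ₂ := (RC R).map g
      τ₃ := relRCMap R f g sq
      comm₁₂ := by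
        change (RC R).map _ ≫ (RC R).map _ = (RC R).map _ ≫ (RC R).map _
        rw [← Functor.map_comp, ← Functor.map_comp, sq]
      comm₂₃ := (cokernel.π_desc _ _ _).symm }
  exact (congrArg (fun q => q.hom x) (HomologicalComplex.HomologySequence.δ_naturality φ
    (relSeq_shortExact R hi) (relSeq_shortExact R hj) (n + 1) n rfl)).symm

theorem RH.map_map (sq : i ≫ g = f ≫ j) (n : ℕ) (a : RH R n A) :
    RH.map R n g (RH.map R n i a) = RH.map R n j (RH.map R n f a) := by
  have := congrArg (fun q => HomologicalComplex.homologyMap ((RC R).map q) n) sq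
  simp only [Functor.map_comp, HomologicalComplex.homologyMap_comp] at this
  exact congrArg (fun q => q.hom a) this

end LongExactSequence

end DiGraph

theorem mainTheorem1 (R : Type w) [CommRing R] {A X Y Z : DiGraph.{u}}
    (i : A ⟶ X) (hi : DiGraph.IsLongCofibration i) (f : A ⟶ Y)
    (g : X ⟶ Z) (j : Y ⟶ Z) (sq : IsPushout i f g j) :
    Function.Injective j.toFun ∧
    (∀ n : ℕ, Function.Bijective (DiGraph.relRH.map R n f g sq.w)) ∧
    ∃ δ : ∀ n : ℕ, DiGraph.RH R (n + 1) Z →ₗ[R] DiGraph.RH R n A,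
      (∀ n : ℕ, Function.Exact
        ((-DiGraph.RH.map R n i).prod (DiGraph.RH.map R n f))
        ((DiGraph.RH.map R n g).coprod (DiGraph.RH.map R n j))) ∧
      (∀ n : ℕ, Function.Exact
        ((DiGraph.RH.map R (n + 1) g).coprod (DiGraph.RH.map R (n + 1) j)) (δ n)) ∧
      (∀ n : ℕ, Function.Exact (δ n)
        ((-DiGraph.RH.map R n i).prod (DiGraph.RH.map R n f))) ∧
      Function.Surjective ((DiGraph.RH.map R 0 g).coprod (DiGraph.RH.map R 0 j)) := by
  have h := hi.isGluing sq
  have hj := h.injective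
  have hexc := h.excision R sq.w hi.isCoreflective
  let e (n : ℕ) := LinearEquiv.ofBijective (DiGraph.relRH.map R n f g sq.w) (hexc n)
  refine ⟨hj, hexc, fun n => DiGraph.barrattWhiteheadδ (DiGraph.relRH.δ R hi.injective n)
    (e (n + 1)) (DiGraph.relRH.proj R j (n + 1)), fun n => ?_, fun n => ?_, fun n => ?_, ?_⟩
  · exact DiGraph.barrattWhitehead_exact_sum (e := e n) (e₁ := e (n + 1))
      (DiGraph.relRH.exact_δ_map R hi.injective n) (DiGraph.relRH.exact_map_proj R hi.injective n)
      (DiGraph.relRH.exact_δ_map R hj n) (DiGraph.relRH.exact_map_proj R hj n)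
      (DiGraph.RH.map_map R sq.w n) (DiGraph.relRH.proj_map R sq.w n)
      (DiGraph.relRH.δ_map R sq.w hi.injective hj n)
  · exact DiGraph.barrattWhitehead_exact_right (DiGraph.relRH.exact_proj_δ R hi.injective n)
      (DiGraph.relRH.exact_map_proj R hj (n + 1)) (DiGraph.relRH.proj_map R sq.w (n + 1))
  · exact DiGraph.barrattWhitehead_exact_left (DiGraph.relRH.exact_δ_map R hi.injective n)
      (DiGraph.relRH.exact_proj_δ R hj n) (DiGraph.relRH.δ_map R sq.w hi.injective hj n)
  · exact DiGraph.barrattWhitehead_surjective (e := e 0) (DiGraph.relRH.proj_zero_surjective R i)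
      (DiGraph.relRH.exact_map_proj R hj 0) (DiGraph.relRH.proj_map R sq.w 0)
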